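/- Let $d\in\mathbb{N}=\{1,2,3,\ldots\}$, $p\in\{2,4,6,\ldots\}$, $\alpha\in(0,\infty)$, $\nu\in(0,1)$, $\xi\in\mathbb{R}^d$, let $\langle\cdot,\cdot\rangle$ and $\|\cdot\|$ be the Euclidean scalar product and the Euclidean norm on $\mathbb{R}^d$, let $(\Omega,\mathcal{F},\mathbb{P})$ be a probability space, let $X_n\colon\Omega\to\mathbb{R}^d$, $n\in\mathbb{N}$, be i.i.d. random variables, let $h\colon\mathbb{R}^d\to\mathbb{R}$ be Borel measurable, and assume that $$\mathbb{E}\big[\|h(X_1)X_1\|^p+|h(X_1)|^2+\|X_1\|^{2p}\big]<\infty .$$ Assume that the matrix $\mathbb{E}[X_1X_1^*]\in\mathbb{R}^{d\times d}$ is invertible, where $v^*$ denotes the transpose of $v \in \mathbb{R}^d$, and let $$\vartheta=\big(\mathbb{E}[X_1X_1^*]\big)^{-1}\,\mathbb{E}[h(X_1)X_1]\in\mathbb{R}^d .$$ Let $F\colon\mathbb{R}^d\times\mathbb{R}^d\to\mathbb{R}$ be given by $F(\theta,x)=(\langle\theta,x\rangle-h(x))^2$, and let $\Theta\colon\{0,1,2,\ldots\}\times\Omega\to\mathbb{R}^d$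 be the stochastic process which satisfies for all $n\in\mathbb{N}$ that $$\Theta_0=\xi\qquad\text{and}\qquad \Theta_n=\Theta_{n-1}-\frac{\alpha}{n^\nu}\,(\nabla_\theta F)(\Theta_{n-1},X_n).$$ Then (i) for all $\theta\in\mathbb{R}^d$ it holds that $\mathbb{E}\big[|F(\theta,X_1)|\big]<\infty$, (ii) it holds that $\big\{\theta\in\mathbb{R}^d\colon \mathbb{E}[F(\theta,X_1)]=\inf_{v\in\mathbb{R}^d}\mathbb{E}[F(v,X_1)]\big\}=\{\vartheta\}$, and (iii) there exists $C\in(0,\infty)$ such that for all $n\in\mathbb{N}$ it holds that $$\big(\mathbb{E}\big[\|\Theta_n-\vartheta\|^p\big]\big)^{1/p}\le C\,n^{-\nu/2}.$$ -/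

import Mathlib

open MeasureTheory ProbabilityTheory

noncomputable section

/-- The least-squares loss `F(θ, x) = (⟨θ, x⟩ - h(x))²` on `ℝ^d × ℝ^d`. -/
def leastSquaresLoss {d : ℕ} (h : EuclideanSpace ℝ (Fin d) → ℝ)
    (θ x : EuclideanSpace ℝ (Fin d)) : ℝ :=
  (inner ℝ θ x - h x) ^ 2

/-- The `d × d` matrix `E[Y Y*]` (the expectation of a matrix is taken entrywise). -/
def secondMomentMatrix {d : ℕ} {Ω : Type*} [MeasurableSpace Ω] (P : Measure Ω)
    (Y : Ω → EuclideanSpace ℝ (Fin d)) : Matrix (Fin d) (Fin d) ℝ :=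
  Matrix.of fun i j => ∫ ω, Y ω i * Y ω j ∂P

end

/-! Put `δ = θ - ϑ`. The definition of `ϑ` is the normal equation, i.e. the residual `⟨ϑ, X⟩ - h(X)`
is orthogonal in `L²` to all `⟨v, X⟩`. Hence `E F(θ, X) = E F(ϑ, X) + E⟨δ, X⟩²`, and invertibility
gives `E⟨δ, X⟩² ≥ κ‖δ‖²` with `κ > 0`; this settles the minimiser.

For the rate write `p = 2(q + 1)`. Expanding `‖δ - γG‖^p` to first order, with `G` the gradient, the
mean of the linear term is at most `-2p κγ‖δ‖^p`. Half of this drift absorbs the second-order term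
up to `O(γ^(q+2))`. Since the new sample is independent of the past, `m_n = E‖Θ_n - ϑ‖^p` satisfies
`m_{n+1} ≤ (1 - cγ_{n+1}) m_n + D γ_{n+1}^(q+2)` once the steps are small. As `ν < 1`, `γ_n` decays
slowly enough to yield `m_n = O(γ_n^(q+1))`, whose `p`-th root is `O(n^(-ν/2))`. Carried by
`exists_integral_norm_step_pow_le`, `exists_le_mul_pow_of_recursion` and
`exists_mul_norm_sq_le_integral_inner_sq`. -/

open Filter Topology

/-! ### Expansion of even powers of the norm -/

/-- First-order Taylor bound for powers, in the form suited to `u = a²` and `u + t = ‖x - y‖²`. -/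
theorem exists_abs_pow_sub_taylor_le (q : ℕ) : ∃ K : ℝ, 0 ≤ K ∧ ∀ u t g w : ℝ, 0 ≤ u → 0 ≤ g →
    0 ≤ w → u ≤ w ^ 2 → |t| ≤ 2 * g * w → |u + t| ≤ w ^ 2 →
    |(u + t) ^ (q + 1) - u ^ (q + 1) - (q + 1) * u ^ q * t| ≤ K * g ^ 2 * w ^ (2 * q) := by
  induction q with
  | zero => exact ⟨0, le_rfl, fun u t g w _ _ _ _ _ _ => by simp⟩
  | succ q ih =>
    obtain ⟨K, hK, ih⟩ := ih
    refine ⟨K + 4 * (q + 1), by positivity, fun u t g w hu hg hw huw htw hutw => ?_⟩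
    have h1 := ih u t g w hu hg hw huw htw hutw
    -- The remainders satisfy `R_{q+1} = (u + t) R_q + (q + 1) u^q t²`; the bound `t² ≤ 4g²w²` gives
    -- the increment `4(q + 1)` of the constant.
    have h2 : (u + t) ^ (q + 1 + 1) - u ^ (q + 1 + 1) - ((q + 1 : ℕ) + 1) * u ^ (q + 1) * t =
        (u + t) * ((u + t) ^ (q + 1) - u ^ (q + 1) - (q + 1) * u ^ q * t) +
          (q + 1) * (u ^ q * t ^ 2) := by
      push_cast; ring
    have h3 : u ^ q ≤ w ^ (2 * q) := by
      rw [pow_mul]; exact pow_le_pow_left₀ hu huw q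
    have h4 : t ^ 2 ≤ (2 * g * w) ^ 2 := by
      rw [← sq_abs t]; exact pow_le_pow_left₀ (abs_nonneg _) htw 2
    rw [h2]
    calc _ ≤ |u + t| * |(u + t) ^ (q + 1) - u ^ (q + 1) - (q + 1) * u ^ q * t| +
          (q + 1) * (u ^ q * t ^ 2) := by
          refine (abs_add_le _ _).trans ?_
          rw [abs_mul, abs_of_nonneg (a := ((q : ℝ) + 1) * (u ^ q * t ^ 2)) (by positivity)]
      _ ≤ w ^ 2 * (K * g ^ 2 * w ^ (2 * q)) + (q + 1) * (w ^ (2 * q) * (2 * g * w) ^ 2) := by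
          gcongr
      _ = _ := by ring

theorem exists_norm_sub_pow_le (E : Type*) [NormedAddCommGroup E] [InnerProductSpace ℝ E] (q : ℕ) :
    ∃ K : ℝ, 0 ≤ K ∧ ∀ x y : E, ‖x - y‖ ^ (2 * (q + 1)) ≤
      ‖x‖ ^ (2 * (q + 1)) - 2 * (q + 1) * ‖x‖ ^ (2 * q) * inner ℝ x y +
        K * ‖y‖ ^ 2 * (‖x‖ + ‖y‖) ^ (2 * q) := by
  obtain ⟨K, hK, H⟩ := exists_abs_pow_sub_taylor_le q
  -- The extra `q + 1` pays for the `‖y‖²` part of `t = -2⟨x, y⟩ + ‖y‖²` in the linear term.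
  refine ⟨K + (q + 1), by positivity, fun x y => ?_⟩
  have hxy : ‖x - y‖ ^ 2 = ‖x‖ ^ 2 + (-2 * inner ℝ x y + ‖y‖ ^ 2) := by
    rw [norm_sub_sq_real]; ring
  have hin := abs_real_inner_le_norm x y
  have hx := norm_nonneg x
  have hy := norm_nonneg y
  have h1 := H (‖x‖ ^ 2) (-2 * inner ℝ x y + ‖y‖ ^ 2) ‖y‖ (‖x‖ + ‖y‖) (by positivity) hy
    (by positivity) (by gcongr; linarith)
    (by
      have h := abs_le.1 hin
      rw [abs_le]
      constructor <;> nlinarith [mul_nonneg hx hy, sq_nonneg ‖y‖])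
    (by
      rw [← hxy, abs_of_nonneg (by positivity)]
      gcongr
      exact norm_sub_le x y)
  have h2 := (abs_le.1 h1).2
  rw [← hxy] at h2
  have h3 : ‖x‖ ^ (2 * q) ≤ (‖x‖ + ‖y‖) ^ (2 * q) := by gcongr; linarith
  have h4 : ((q : ℝ) + 1) * ‖y‖ ^ 2 * ‖x‖ ^ (2 * q) ≤
      ((q : ℝ) + 1) * ‖y‖ ^ 2 * (‖x‖ + ‖y‖) ^ (2 * q) := by gcongr
  simp only [← pow_mul] at h2
  linarith [h2, h4]

/-- With `γ = s²` the left side is `K (sa + s)² (2a + s²)^(2q)`. If `s ≤ s₀ a`, both bases are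
multiples of `a`, the first with the small factor `s₀`, so `c` absorbs the product. Otherwise `a ≤ s
/ s₀` and everything has order `s^(2(q+1)) = γ^(q+1)`. -/
theorem exists_absorb (q : ℕ) (K c : ℝ) (hK : 0 ≤ K) (hc : 0 < c) :
    ∃ γ₀ : ℝ, 0 < γ₀ ∧ γ₀ ≤ 1 ∧ ∃ D : ℝ, 0 ≤ D ∧ ∀ γ a : ℝ, 0 < γ → γ ≤ γ₀ → 0 ≤ a →
      K * γ * (a + 1) ^ 2 * (2 * a + γ) ^ (2 * q) ≤
        c * a ^ (2 * (q + 1)) + D * γ ^ (q + 1) := by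
  obtain ⟨s₀, hs₀, hs₁, hs₂⟩ : ∃ s₀ : ℝ, 0 < s₀ ∧ s₀ ≤ 1 ∧ K * (4 * 3 ^ (2 * q)) * s₀ ≤ c := by
    have hB : 0 < K * (4 * 3 ^ (2 * q)) + 1 := by positivity
    refine ⟨min 1 (c / (K * (4 * 3 ^ (2 * q)) + 1)), by positivity, min_le_left _ _, ?_⟩
    have h1 := min_le_right 1 (c / (K * (4 * 3 ^ (2 * q)) + 1))
    rw [le_div_iff₀ hB] at h1
    have h2 : 0 ≤ min 1 (c / (K * (4 * 3 ^ (2 * q)) + 1)) := by positivity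
    linarith
  refine ⟨s₀ ^ 2, by positivity, pow_le_one₀ hs₀.le hs₁,
    K * (1 / s₀ + 1) ^ 2 * (2 * (1 / s₀) + 1) ^ (2 * q), by positivity, fun γ a hγ hγ₀ ha => ?_⟩
  obtain ⟨s, hs, rfl⟩ : ∃ s : ℝ, 0 < s ∧ s ^ 2 = γ :=
    ⟨√γ, Real.sqrt_pos.2 hγ, Real.sq_sqrt hγ.le⟩
  have hss : s ≤ s₀ := (sq_le_sq₀ hs.le hs₀.le).1 hγ₀
  have hs1 : s ≤ 1 := hss.trans hs₁
  have hsq : s ^ 2 ≤ s := by nlinarith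
  have hrew : K * s ^ 2 * (a + 1) ^ 2 * (2 * a + s ^ 2) ^ (2 * q) =
      K * ((s * a + s) ^ 2 * (2 * a + s ^ 2) ^ (2 * q)) := by ring
  rw [hrew]
  rcases le_total s (s₀ * a) with hcase | hcase
  · have h1 : s * a + s ≤ 2 * s₀ * a := by nlinarith
    have h2 : 2 * a + s ^ 2 ≤ 3 * a := by nlinarith
    calc K * ((s * a + s) ^ 2 * (2 * a + s ^ 2) ^ (2 * q))
        ≤ K * ((2 * s₀ * a) ^ 2 * (3 * a) ^ (2 * q)) := by gcongr
      _ = (K * (4 * 3 ^ (2 * q)) * s₀) * s₀ * a ^ (2 * (q + 1)) := by ring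
      _ ≤ c * 1 * a ^ (2 * (q + 1)) := by gcongr
      _ ≤ _ := by
        have : 0 ≤ K * (1 / s₀ + 1) ^ 2 * (2 * (1 / s₀) + 1) ^ (2 * q) * (s ^ 2) ^ (q + 1) := by
          positivity
        linarith
  · have h0 : a ≤ 1 / s₀ * s := by
      rw [one_div, inv_mul_eq_div, le_div_iff₀ hs₀]; linarith
    have h1 : s * a + s ≤ (1 / s₀ + 1) * s := by nlinarith
    have h2 : 2 * a + s ^ 2 ≤ (2 * (1 / s₀) + 1) * s := by linarith
    calc K * ((s * a + s) ^ 2 * (2 * a + s ^ 2) ^ (2 * q))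
        ≤ K * (((1 / s₀ + 1) * s) ^ 2 * ((2 * (1 / s₀) + 1) * s) ^ (2 * q)) := by gcongr
      _ = K * (1 / s₀ + 1) ^ 2 * (2 * (1 / s₀) + 1) ^ (2 * q) * (s ^ 2) ^ (q + 1) := by
        rw [mul_pow, mul_pow, ← pow_mul s 2 (q + 1)]; ring
      _ ≤ _ := by
        have : 0 ≤ c * a ^ (2 * (q + 1)) := by positivity
        linarith

/-! ### Deterministic recursion and step sizes -/

/-- Induction on `m n ≤ C γ_n^r`: since `(1 - cg)(1 + cg/2) ≤ 1 - cg/2`, a surplus `(C c/2) g^(r+1)`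
is left, which covers `D g^(r+1)` when `C ≥ 2D/c`. The finitely many indices up to `N` only enlarge
`C`, through `B`. -/
theorem exists_le_mul_pow_of_recursion (r : ℕ) (m γ : ℕ → ℝ) (c D : ℝ) (hc : 0 < c)
    (hγ : ∀ n, 1 ≤ n → 0 < γ n)
    (hcγ : ∀ᶠ n in atTop, c * γ (n + 1) ≤ 1)
    (hratio : ∀ᶠ n in atTop, γ n ^ r ≤ (1 + c / 2 * γ (n + 1)) * γ (n + 1) ^ r)
    (hm : ∀ᶠ n in atTop, m (n + 1) ≤ (1 - c * γ (n + 1)) * m n + D * γ (n + 1) ^ (r + 1)) :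
    ∃ C : ℝ, 0 < C ∧ ∀ n, 1 ≤ n → m n ≤ C * γ n ^ r := by
  obtain ⟨N, hN⟩ := eventually_atTop.1 (hcγ.and (hratio.and (hm.and (eventually_ge_atTop 1))))
  have hN1 : 1 ≤ N := (hN N le_rfl).2.2.2
  obtain ⟨B, hB⟩ : ∃ B : ℝ, ∀ n ∈ Finset.range (N + 1), m n / γ n ^ r ≤ B := by
    obtain ⟨B, hB⟩ := ((Finset.range (N + 1)).image fun n => m n / γ n ^ r).bddAbove
    exact ⟨B, fun n hn => hB (by simpa using ⟨n, by simpa using hn, rfl⟩)⟩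
  refine ⟨max (max B (2 * D / c)) 1, by positivity, ?_⟩
  set C := max (max B (2 * D / c)) 1
  have hC1 : 0 < C := by positivity
  have hCB : B ≤ C := (le_max_left _ _).trans (le_max_left _ _)
  have hCD : 2 * D ≤ C * c := by
    rw [← div_le_iff₀ hc]; exact (le_max_right _ _).trans (le_max_left _ _)
  have small : ∀ n, 1 ≤ n → n ≤ N → m n ≤ C * γ n ^ r := fun n h1 hn => by
    have := hB n (by simpa [Nat.lt_succ_iff] using hn)
    rw [div_le_iff₀ (pow_pos (hγ n h1) r)] at this
    exact this.trans (by have := pow_pos (hγ n h1) r; gcongr)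
  intro n hn
  rcases le_total n N with h | h
  · exact small n hn h
  · induction n, h using Nat.le_induction with
    | base => exact small N hN1 le_rfl
    | succ n hNn ih =>
      obtain ⟨h1, h2, h3, h4⟩ := hN n hNn
      have hg := hγ (n + 1) (by omega)
      set g := γ (n + 1)
      have hgr : 0 < g ^ r := by positivity
      calc m (n + 1) ≤ (1 - c * g) * m n + D * g ^ (r + 1) := h3
        _ ≤ (1 - c * g) * (C * ((1 + c / 2 * g) * g ^ r)) + D * g ^ (r + 1) := by
          have : 0 ≤ 1 - c * g := by linarith
          have := ih h4
          gcongr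
          exact this.trans (by gcongr)
        _ = C * g ^ r - g ^ r * g * ((C * c / 2 - D) + C * c ^ 2 / 2 * g) := by ring
        _ ≤ C * g ^ r := by
          have : 0 ≤ g ^ r * g * ((C * c / 2 - D) + C * c ^ 2 / 2 * g) := by
            have : 0 ≤ C * c / 2 - D := by linarith
            positivity
          linarith

theorem one_add_pow_le_one_add_two_pow_mul (r : ℕ) (x : ℝ) (hx : 0 ≤ x) (hx1 : x ≤ 1) :
    (1 + x) ^ r ≤ 1 + 2 ^ r * x := by
  induction r with
  | zero => simpa using hx
  | succ r ih =>
    have h1 : (1 : ℝ) ≤ 2 ^ r := one_le_pow₀ (by norm_num)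
    calc (1 + x) ^ (r + 1) = (1 + x) ^ r + (1 + x) ^ r * x := by ring
      _ ≤ (1 + 2 ^ r * x) + 2 ^ r * x := by
        gcongr
        linarith
      _ = 1 + 2 ^ (r + 1) * x := by ring

theorem tendsto_div_natCast_rpow (α ν : ℝ) (hν : 0 < ν) :
    Tendsto (fun n : ℕ => α / (n : ℝ) ^ ν) atTop (𝓝 0) :=
  ((tendsto_rpow_atTop hν).comp tendsto_natCast_atTop_atTop).const_div_atTop α

/-- The ratio of consecutive steps is at most `1 + 1/n`, so its `r`-th power is at most `1 + 2^r/n`,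
and `1/n` is negligible against `n^(-ν)` because `ν < 1`. -/
theorem eventually_stepSize_pow_le (r : ℕ) (α ν c : ℝ) (hα : 0 < α) (hν : ν ∈ Set.Ioo (0 : ℝ) 1)
    (hc : 0 < c) :
    ∀ᶠ n : ℕ in atTop, (α / (n : ℝ) ^ ν) ^ r ≤
      (1 + c / 2 * (α / ((n + 1 : ℕ) : ℝ) ^ ν)) * (α / ((n + 1 : ℕ) : ℝ) ^ ν) ^ r := by
  -- The factor `2` comes from `1/n ≤ 2/(n + 1)`.
  have hlim := ((tendsto_add_atTop_iff_nat 1).2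
    (tendsto_div_natCast_rpow (2 ^ r * 2) (1 - ν) (by linarith [hν.2])))
  filter_upwards [hlim.eventually_le_const (show 0 < c / 2 * α by positivity),
    eventually_ge_atTop 1] with n hn hn1
  have hnR : (1 : ℝ) ≤ n := by exact_mod_cast hn1
  have hn0 : (0 : ℝ) < n := by linarith
  have hN : (0 : ℝ) < ((n + 1 : ℕ) : ℝ) := by positivity
  set g := α / ((n + 1 : ℕ) : ℝ) ^ ν with hg
  have hg0 : 0 < g := by positivity
  have h1 : α / (n : ℝ) ^ ν ≤ (1 + 1 / n) * g := by
    have e : ((n + 1 : ℕ) : ℝ) = (1 + 1 / n) * n := by push_cast; field_simp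
    have h2 : ((n + 1 : ℕ) : ℝ) ^ ν ≤ (1 + 1 / n) * (n : ℝ) ^ ν := by
      rw [e, Real.mul_rpow (by positivity) hn0.le]
      gcongr
      have : (1 : ℝ) ≤ 1 + 1 / n := by simp
      calc (1 + 1 / (n : ℝ)) ^ ν ≤ (1 + 1 / (n : ℝ)) ^ (1 : ℝ) :=
            Real.rpow_le_rpow_of_exponent_le this hν.2.le
        _ = _ := Real.rpow_one _
    rw [hg, mul_div_assoc', div_le_div_iff₀ (by positivity) (by positivity)]
    nlinarith
  have h3 : 2 ^ r * (1 / (n : ℝ)) ≤ c / 2 * g := by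
    have h4 : 2 ^ r * (1 / (n : ℝ)) ≤ 2 ^ r * 2 / ((n + 1 : ℕ) : ℝ) := by
      rw [mul_one_div, div_le_div_iff₀ hn0 hN]
      push_cast
      have : (0 : ℝ) < 2 ^ r := by positivity
      nlinarith
    refine h4.trans ?_
    rw [Real.rpow_sub hN, Real.rpow_one, div_div_eq_mul_div, div_le_iff₀ hN] at hn
    rw [hg, mul_div_assoc', le_div_iff₀ (by positivity), div_mul_eq_mul_div, div_le_iff₀ hN]
    exact hn
  calc (α / (n : ℝ) ^ ν) ^ r ≤ ((1 + 1 / n) * g) ^ r := by gcongr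
    _ = (1 + 1 / (n : ℝ)) ^ r * g ^ r := mul_pow _ _ _
    _ ≤ (1 + 2 ^ r * (1 / (n : ℝ))) * g ^ r := by
      gcongr
      exact one_add_pow_le_one_add_two_pow_mul r _ (by positivity)
        (by rw [div_le_one hn0]; exact hnR)
    _ ≤ _ := by gcongr

/-! ### Moments along the stochastic recursion -/

/-- One step from a frozen `δ`. The drift is `-2(q + 1)κγ‖δ‖^(2(q+1))`; one half is spent in
`exists_absorb` on the second-order term. -/
theorem exists_integral_norm_step_pow_le {Ω E F : Type*} [MeasurableSpace Ω] {P : Measure Ω}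
    [IsProbabilityMeasure P] [NormedAddCommGroup E] [InnerProductSpace ℝ E] (q : ℕ) {Y : Ω → F}
    {G : E → F → E} {Z : F → ℝ} (hZ0 : ∀ y, 0 ≤ Z y)
    (hZ : Integrable (fun ω => (1 + Z (Y ω)) ^ (2 * (q + 1))) P)
    (hGZ : ∀ δ y, ‖G δ y‖ ≤ Z y * (‖δ‖ + 1)) {κ : ℝ} (hκ : 0 < κ)
    (hGi : ∀ δ, Integrable (fun ω => inner ℝ δ (G δ (Y ω))) P)
    (hGκ : ∀ δ, κ * ‖δ‖ ^ 2 ≤ ∫ ω, inner ℝ δ (G δ (Y ω)) ∂P) :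
    ∃ γ₀ : ℝ, 0 < γ₀ ∧ ∃ D : ℝ, ∀ γ : ℝ, 0 < γ → γ ≤ γ₀ → ∀ δ : E,
      ∫ ω, ‖δ - γ • G δ (Y ω)‖ ^ (2 * (q + 1)) ∂P ≤
        (1 - (q + 1) * κ * γ) * ‖δ‖ ^ (2 * (q + 1)) + D * γ ^ (q + 1 + 1) := by
  obtain ⟨K, hK, hstep⟩ := exists_norm_sub_pow_le E q
  set M := ∫ ω, (1 + Z (Y ω)) ^ (2 * (q + 1)) ∂P with hM
  have hM0 : 0 ≤ M := integral_nonneg fun ω => by have := hZ0 (Y ω); positivity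
  obtain ⟨γ₀, hγ₀, hγ₁, D, hD, habs⟩ := exists_absorb q (K * M) ((q + 1) * κ) (by positivity)
    (by positivity)
  refine ⟨γ₀, hγ₀, D, fun γ hγ hγγ δ => ?_⟩
  have ha := norm_nonneg δ
  have hγ1 : γ ≤ 1 := hγγ.trans hγ₁
  -- Bounding `Z` by `1 + Z` lets both factors of the remainder split into a deterministic part
  -- times a power of `1 + Z`, of total degree `2(q + 1)`.
  have hpt : ∀ ω, ‖δ - γ • G δ (Y ω)‖ ^ (2 * (q + 1)) ≤ ‖δ‖ ^ (2 * (q + 1)) -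
      2 * (q + 1) * ‖δ‖ ^ (2 * q) * γ * inner ℝ δ (G δ (Y ω)) +
      K * γ ^ 2 * (‖δ‖ + 1) ^ 2 * (2 * ‖δ‖ + γ) ^ (2 * q) * (1 + Z (Y ω)) ^ (2 * (q + 1)) := by
    intro ω
    have hz := hZ0 (Y ω)
    have h1 := hstep δ (γ • G δ (Y ω))
    rw [inner_smul_right, norm_smul, Real.norm_of_nonneg hγ.le] at h1
    have h2 : γ * ‖G δ (Y ω)‖ ≤ γ * (‖δ‖ + 1) * (1 + Z (Y ω)) := by
      rw [mul_assoc]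
      have := hGZ δ (Y ω)
      gcongr
      nlinarith
    have h3 : ‖δ‖ + γ * ‖G δ (Y ω)‖ ≤ (2 * ‖δ‖ + γ) * (1 + Z (Y ω)) := by
      have : γ * ‖δ‖ ≤ ‖δ‖ := mul_le_of_le_one_left ha hγ1
      nlinarith [mul_nonneg ha hz]
    have h4 : K * (γ * ‖G δ (Y ω)‖) ^ 2 * (‖δ‖ + γ * ‖G δ (Y ω)‖) ^ (2 * q) ≤
        K * (γ * (‖δ‖ + 1) * (1 + Z (Y ω))) ^ 2 *
          ((2 * ‖δ‖ + γ) * (1 + Z (Y ω))) ^ (2 * q) := by gcongr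
    refine h1.trans ?_
    have h5 : K * (γ * (‖δ‖ + 1) * (1 + Z (Y ω))) ^ 2 *
          ((2 * ‖δ‖ + γ) * (1 + Z (Y ω))) ^ (2 * q) = K * γ ^ 2 * (‖δ‖ + 1) ^ 2 *
          (2 * ‖δ‖ + γ) ^ (2 * q) * (1 + Z (Y ω)) ^ (2 * (q + 1)) := by
      rw [mul_pow (2 * ‖δ‖ + γ)]; ring
    linarith
  have hi1 : Integrable (fun ω => ‖δ‖ ^ (2 * (q + 1)) -
      2 * (q + 1) * ‖δ‖ ^ (2 * q) * γ * inner ℝ δ (G δ (Y ω))) P :=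
    (integrable_const _).sub ((hGi δ).const_mul _)
  have hi2 := hZ.const_mul (K * γ ^ 2 * (‖δ‖ + 1) ^ 2 * (2 * ‖δ‖ + γ) ^ (2 * q))
  have h1 := integral_mono_of_nonneg (ae_of_all _ fun ω => by positivity) (hi1.add hi2)
    (ae_of_all _ hpt)
  refine h1.trans ?_
  simp only [Pi.add_apply]
  rw [integral_add hi1 hi2, integral_sub (integrable_const _) ((hGi δ).const_mul _),
    integral_const_mul, integral_const_mul, ← hM]
  simp only [integral_const, probReal_univ, one_smul]
  have h2 := mul_le_mul_of_nonneg_left (hGκ δ)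
    (show 0 ≤ 2 * ((q : ℝ) + 1) * ‖δ‖ ^ (2 * q) * γ by positivity)
  have h3 := mul_le_mul_of_nonneg_left (habs γ ‖δ‖ hγ hγγ ha) hγ.le
  have e1 : 2 * ((q : ℝ) + 1) * ‖δ‖ ^ (2 * q) * γ * (κ * ‖δ‖ ^ 2) =
    2 * ((q + 1) * κ * γ * ‖δ‖ ^ (2 * (q + 1))) := by ring
  have e2 : γ * (K * M * γ * (‖δ‖ + 1) ^ 2 * (2 * ‖δ‖ + γ) ^ (2 * q)) =
    K * γ ^ 2 * (‖δ‖ + 1) ^ 2 * (2 * ‖δ‖ + γ) ^ (2 * q) * M := by ring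
  have e3 : γ * ((q + 1) * κ * ‖δ‖ ^ (2 * (q + 1)) + D * γ ^ (q + 1)) =
    (q + 1) * κ * γ * ‖δ‖ ^ (2 * (q + 1)) + D * γ ^ (q + 1 + 1) := by ring
  linarith

/-- Fubini on the product law; it replaces conditioning on the past by a bound for each frozen `u`.
-/
theorem ProbabilityTheory.IndepFun.integral_comp_le {Ω E F : Type*} [MeasurableSpace Ω]
    {P : Measure Ω} [IsProbabilityMeasure P] [MeasurableSpace E] [MeasurableSpace F] {U : Ω → E} {V : Ω → F} (hU : Measurable U) (hV : Measurable V)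
    (hUV : IndepFun U V P) {Φ : E → F → ℝ} (hΦ : Measurable fun z : E × F => Φ z.1 z.2)
    (hi : Integrable (fun ω => Φ (U ω) (V ω)) P) {ψ : E → ℝ} (hψ : Measurable ψ)
    (hψi : Integrable (fun ω => ψ (U ω)) P) (hle : ∀ u, ∫ ω, Φ u (V ω) ∂P ≤ ψ u) :
    ∫ ω, Φ (U ω) (V ω) ∂P ≤ ∫ ω, ψ (U ω) ∂P := by
  have hmap := (indepFun_iff_map_prod_eq_prod_map_map hU.aemeasurable hV.aemeasurable).1 hUV
  have hUVm : Measurable fun ω => (U ω, V ω) := hU.prodMk hV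
  have := Measure.isProbabilityMeasure_map (μ := P) hU.aemeasurable
  have := Measure.isProbabilityMeasure_map (μ := P) hV.aemeasurable
  have hi' : Integrable (fun z : E × F => Φ z.1 z.2) ((P.map U).prod (P.map V)) := by
    rw [← hmap]
    exact (integrable_map_measure hΦ.aestronglyMeasurable hUVm.aemeasurable).2 hi
  calc ∫ ω, Φ (U ω) (V ω) ∂P
      = ∫ z, Φ z.1 z.2 ∂((P.map U).prod (P.map V)) := by
        rw [← hmap, integral_map hUVm.aemeasurable hΦ.aestronglyMeasurable]
    _ = ∫ u, ∫ v, Φ u v ∂(P.map V) ∂(P.map U) := integral_prod _ hi'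
    _ ≤ ∫ u, ψ u ∂(P.map U) := by
        refine integral_mono hi'.integral_prod_left
          ((integrable_map_measure hψ.aestronglyMeasurable hU.aemeasurable).2 hψi) fun u => ?_
        have hm : Measurable (Φ u) := hΦ.comp measurable_prodMk_left
        simpa only [integral_map hV.aemeasurable hm.aestronglyMeasurable] using hle u
    _ = _ := integral_map hU.aemeasurable hψ.aestronglyMeasurable

theorem indepFun_of_recursion {Ω E F : Type*} [MeasurableSpace Ω] {P : Measure Ω}
    [MeasurableSpace E] [MeasurableSpace F]
    {Y : ℕ → Ω → F} (hY : ∀ n, Measurable (Y n)) (hind : iIndepFun Y P)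
    {S : ℕ → E → F → E} (hS : ∀ n, Measurable fun z : E × F => S n z.1 z.2) {Δ : ℕ → Ω → E}
    {δ₀ : E} (hΔ0 : ∀ ω, Δ 0 ω = δ₀) (hΔ : ∀ n ω, Δ (n + 1) ω = S n (Δ n ω) (Y n ω)) (n : ℕ) :
    Measurable (Δ n) ∧ IndepFun (Δ n) (Y n) P := by
  -- `Y n` drives the step from `n` to `n + 1`, so `Δ n` depends only on the `Y i` with `i < n`.
  have hm : ∀ n, Measurable[⨆ i ∈ Set.Iio n, MeasurableSpace.comap (Y i) inferInstance] (Δ n) := by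
    intro n
    induction n with
    | zero =>
      rw [show Δ 0 = fun _ => δ₀ from funext hΔ0]
      exact measurable_const
    | succ n ih =>
      rw [show Δ (n + 1) = fun ω => S n (Δ n ω) (Y n ω) from funext (hΔ n)]
      have h1 : Measurable[⨆ i ∈ Set.Iio (n + 1), MeasurableSpace.comap (Y i) inferInstance]
          (Δ n) :=
        ih.mono (biSup_mono fun i hi => Set.mem_Iio.2 ((Set.mem_Iio.1 hi).trans n.lt_succ_self))
          le_rfl
      have h2 : Measurable[⨆ i ∈ Set.Iio (n + 1), MeasurableSpace.comap (Y i) inferInstance]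
          (Y n) :=
        (comap_measurable (Y n)).mono
          (le_biSup (fun i => MeasurableSpace.comap (Y i) inferInstance)
            (Set.mem_Iio.2 n.lt_succ_self)) le_rfl
      exact (hS n).comp (h1.prodMk h2)
  have hle : ∀ i, MeasurableSpace.comap (Y i) inferInstance ≤ ‹MeasurableSpace Ω› :=
    fun i => (hY i).comap_le
  refine ⟨(hm n).mono (iSup₂_le fun i _ => hle i) le_rfl, ?_⟩
  have h := indep_iSup_of_disjoint hle hind (S := Set.Iio n) (T := {n})
    (Set.disjoint_singleton_right.2 (by simp))
  rw [IndepFun_iff_Indep]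
  refine indep_of_indep_of_le_left (indep_of_indep_of_le_right h ?_) (hm n).comap_le
  simp

theorem exists_integral_norm_pow_le_stepSize {Ω E F : Type*} [MeasurableSpace Ω]
    {P : Measure Ω} [IsProbabilityMeasure P] [NormedAddCommGroup E] [InnerProductSpace ℝ E]
    [FiniteDimensional ℝ E] [MeasurableSpace E] [BorelSpace E] [MeasurableSpace F] (q : ℕ) {α ν : ℝ} (hα : 0 < α)
    (hν : ν ∈ Set.Ioo (0 : ℝ) 1) {Y : ℕ → Ω → F} (hY : ∀ n, Measurable (Y n))
    (hind : iIndepFun Y P) (hident : ∀ n, IdentDistrib (Y n) (Y 0) P P)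
    {G : E → F → E} (hG : Measurable fun z : E × F => G z.1 z.2)
    {Z : F → ℝ} (hZm : Measurable Z) (hZ0 : ∀ y, 0 ≤ Z y)
    (hZ : Integrable (fun ω => (1 + Z (Y 0 ω)) ^ (2 * (q + 1))) P)
    (hGZ : ∀ δ y, ‖G δ y‖ ≤ Z y * (‖δ‖ + 1)) {κ : ℝ} (hκ : 0 < κ)
    (hGi : ∀ δ, Integrable (fun ω => inner ℝ δ (G δ (Y 0 ω))) P)
    (hGκ : ∀ δ, κ * ‖δ‖ ^ 2 ≤ ∫ ω, inner ℝ δ (G δ (Y 0 ω)) ∂P)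
    {Δ : ℕ → Ω → E} {δ₀ : E} (hΔ0 : ∀ ω, Δ 0 ω = δ₀)
    (hΔ : ∀ n ω, Δ (n + 1) ω =
      Δ n ω - (α / ((n + 1 : ℕ) : ℝ) ^ ν) • G (Δ n ω) (Y n ω)) :
    (∀ n, Integrable (fun ω => ‖Δ n ω‖ ^ (2 * (q + 1))) P) ∧
    ∃ C : ℝ, 0 < C ∧ ∀ n : ℕ, 1 ≤ n →
      ∫ ω, ‖Δ n ω‖ ^ (2 * (q + 1)) ∂P ≤ C * (α / (n : ℝ) ^ ν) ^ (q + 1) := by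
  have hS : ∀ n : ℕ, Measurable fun z : E × F =>
      z.1 - (α / ((n + 1 : ℕ) : ℝ) ^ ν) • G z.1 z.2 :=
    fun n => measurable_fst.sub (hG.const_smul _)
  have hΔY := indepFun_of_recursion hY hind
    (S := fun n δ y => δ - (α / ((n + 1 : ℕ) : ℝ) ^ ν) • G δ y) hS hΔ0 hΔ
  have hΔi : ∀ n, Integrable (fun ω => ‖Δ n ω‖ ^ (2 * (q + 1))) P := by
    intro n
    induction n with
    | zero => simp only [hΔ0]; exact integrable_const _
    | succ n ih =>
      set g := α / ((n + 1 : ℕ) : ℝ) ^ ν with hg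
      have hg0 : 0 ≤ g := by positivity
      have hZn : Integrable (fun ω => (1 + Z (Y n ω)) ^ (2 * (q + 1))) P :=
        ((hident n).comp (u := fun y => (1 + Z y) ^ (2 * (q + 1)))
          ((hZm.const_add 1).pow_const _)).integrable_iff.2 hZ
      have h1 : Integrable (fun ω => ‖Δ n ω‖ ^ (2 * (q + 1)) + 1) P := ih.add (integrable_const _)
      have hu : Measurable fun δ : E => ‖δ‖ ^ (2 * (q + 1)) + 1 :=
        (measurable_norm.pow_const _).add_const _
      have hv : Measurable fun y => (1 + Z y) ^ (2 * (q + 1)) := (hZm.const_add 1).pow_const _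
      have h2 := ((hΔY n).2.comp hu hv).integrable_mul h1 hZn
      refine (h2.const_mul ((1 + g) ^ (2 * (q + 1)) * 2 ^ (2 * (q + 1) - 1))).mono'
        ((hΔY (n + 1)).1.norm.pow_const _).aestronglyMeasurable (ae_of_all _ fun ω => ?_)
      rw [Real.norm_of_nonneg (by positivity)]
      have hz := hZ0 (Y n ω)
      have ha := norm_nonneg (Δ n ω)
      have h3 : ‖Δ (n + 1) ω‖ ≤ (1 + g) * ((‖Δ n ω‖ + 1) * (1 + Z (Y n ω))) := by
        rw [hΔ, ← hg]
        refine (norm_sub_le _ _).trans ?_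
        rw [norm_smul, Real.norm_of_nonneg hg0]
        have h4 := mul_le_mul_of_nonneg_left (hGZ (Δ n ω) (Y n ω)) hg0
        have h5 : 0 ≤ Z (Y n ω) * (‖Δ n ω‖ + 1) := by positivity
        have h6 : 0 ≤ g * (‖Δ n ω‖ + 1) := by positivity
        nlinarith
      calc ‖Δ (n + 1) ω‖ ^ (2 * (q + 1))
          ≤ ((1 + g) * ((‖Δ n ω‖ + 1) * (1 + Z (Y n ω)))) ^ (2 * (q + 1)) := by gcongr
        _ = (1 + g) ^ (2 * (q + 1)) *
            ((‖Δ n ω‖ + 1) ^ (2 * (q + 1)) * (1 + Z (Y n ω)) ^ (2 * (q + 1))) := by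
          rw [mul_pow, mul_pow]
        _ ≤ (1 + g) ^ (2 * (q + 1)) * ((2 ^ (2 * (q + 1) - 1) *
            (‖Δ n ω‖ ^ (2 * (q + 1)) + 1 ^ (2 * (q + 1)))) * (1 + Z (Y n ω)) ^ (2 * (q + 1))) := by
          gcongr
          exact add_pow_le ha zero_le_one _
        _ = _ := by
          simp only [Pi.mul_apply, Function.comp_apply, one_pow]; ring
  refine ⟨hΔi, ?_⟩
  obtain ⟨γ₀, hγ₀, D, hstep⟩ :=
    exists_integral_norm_step_pow_le q hZ0 hZ hGZ hκ hGi hGκ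
  have hlim := (tendsto_add_atTop_iff_nat 1).2 (tendsto_div_natCast_rpow α ν hν.1)
  refine exists_le_mul_pow_of_recursion (q + 1) (fun n => ∫ ω, ‖Δ n ω‖ ^ (2 * (q + 1)) ∂P)
    (fun n => α / (n : ℝ) ^ ν) ((q + 1) * κ) D (by positivity) (fun n hn => ?_) ?_
    (eventually_stepSize_pow_le (q + 1) α ν ((q + 1) * κ) hα hν (by positivity)) ?_
  · have : (0 : ℝ) < n := by exact_mod_cast hn
    positivity
  · have := hlim.const_mul (((q : ℝ) + 1) * κ)
    rw [mul_zero] at this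
    exact this.eventually_le_const one_pos
  · filter_upwards [hlim.eventually_le_const hγ₀] with n hn
    set g := α / ((n + 1 : ℕ) : ℝ) ^ ν with hg
    have hg0 : 0 < g := by positivity
    have hΦ : Measurable fun z : E × F => ‖z.1 - g • G z.1 z.2‖ ^ (2 * (q + 1)) :=
      (hS n).norm.pow_const _
    have hi : Integrable (fun ω => ‖Δ n ω - g • G (Δ n ω) (Y n ω)‖ ^ (2 * (q + 1))) P := by
      simpa only [hΔ] using hΔi (n + 1)
    have h1 := (hΔY n).2.integral_comp_le (hΔY n).1 (hY n)
      (Φ := fun δ y => ‖δ - g • G δ y‖ ^ (2 * (q + 1))) hΦ hi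
      (ψ := fun δ => (1 - (q + 1) * κ * g) * ‖δ‖ ^ (2 * (q + 1)) + D * g ^ (q + 1 + 1))
      (((measurable_norm.pow_const _).const_mul _).add_const _)
      (((hΔi n).const_mul _).add (integrable_const _)) (fun δ => by
        refine le_trans (le_of_eq ?_) (hstep g hg0 hn δ)
        -- The one-step bound, known for `Y 0`, passes to `Y n` by equality of laws.
        exact ((hident n).comp (u := fun y => ‖δ - g • G δ y‖ ^ (2 * (q + 1)))
          (hΦ.comp measurable_prodMk_left)).integral_eq)
    simp only [hΔ n]
    refine h1.trans (le_of_eq ?_)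
    rw [integral_add ((hΔi n).const_mul _) (integrable_const _), integral_const_mul]
    simp

/-! ### Integrability from the moment assumption -/

theorem MeasureTheory.Integrable.norm_pow_of_le {Ω E : Type*} [MeasurableSpace Ω] {P : Measure Ω}
    [IsFiniteMeasure P] [NormedAddCommGroup E] [MeasurableSpace E] [OpensMeasurableSpace E]
    {Y : Ω → E} {k l : ℕ} (hi : Integrable (fun ω => ‖Y ω‖ ^ l) P) (hY : Measurable Y)
    (hkl : k ≤ l) : Integrable (fun ω => ‖Y ω‖ ^ k) P := by
  refine (hi.add (integrable_const 1)).mono' (hY.norm.pow_const _).aestronglyMeasurable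
    (ae_of_all _ fun ω => ?_)
  rw [Real.norm_of_nonneg (by positivity)]
  simp only [Pi.add_apply]
  rcases le_total ‖Y ω‖ 1 with h | h
  · have h1 := pow_le_one₀ (n := k) (norm_nonneg _) h
    have h2 : 0 ≤ ‖Y ω‖ ^ l := by positivity
    linarith
  · have := pow_le_pow_right₀ h hkl
    linarith

theorem integrable_one_add_add_pow {Ω E : Type*} [MeasurableSpace Ω] {P : Measure Ω}
    [IsFiniteMeasure P] [NormedAddCommGroup E] [MeasurableSpace E] [OpensMeasurableSpace E]
    {Y W : Ω → E} (hY : Measurable Y) (hW : Measurable W) {p : ℕ}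
    (hYi : Integrable (fun ω => ‖Y ω‖ ^ (2 * p)) P) (hWi : Integrable (fun ω => ‖W ω‖ ^ p) P)
    {c : ℝ} (hc : 0 ≤ c) :
    Integrable (fun ω => (1 + (2 * c * ‖Y ω‖ ^ 2 + 2 * ‖W ω‖)) ^ p) P := by
  have hb := ((hYi.const_mul ((2 * c) ^ p)).add (hWi.const_mul (2 ^ p))).const_mul (2 ^ (p - 1))
  refine (((integrable_const 1).add hb).const_mul (2 ^ (p - 1))).mono'
    (((((hY.norm.pow_const 2).const_mul _).add (hW.norm.const_mul _)).const_add
      1).pow_const _).aestronglyMeasurable (ae_of_all _ fun ω => ?_)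
  rw [Real.norm_of_nonneg (by positivity)]
  refine (add_pow_le zero_le_one (by positivity) p).trans ?_
  simp only [Pi.add_apply, one_pow]
  gcongr
  refine (add_pow_le (by positivity) (by positivity) p).trans (le_of_eq ?_)
  rw [mul_pow (2 * c), mul_pow 2 ‖W ω‖, ← pow_mul]

/-! ### The least-squares loss: gradient, normal equation, coercivity -/

section LeastSquares

variable {d : ℕ}

theorem gradient_leastSquaresLoss (h : EuclideanSpace ℝ (Fin d) → ℝ)
    (θ x : EuclideanSpace ℝ (Fin d)) :
    gradient (fun θ => leastSquaresLoss h θ x) θ = (2 * (inner ℝ θ x - h x)) • x := by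
  refine HasGradientAt.gradient ?_
  rw [hasGradientAt_iff_hasFDerivAt]
  have h1 : HasFDerivAt (fun θ : EuclideanSpace ℝ (Fin d) => inner ℝ θ x - h x)
      (InnerProductSpace.toDual ℝ _ x) θ := by
    have := (InnerProductSpace.toDual ℝ (EuclideanSpace ℝ (Fin d)) x).hasFDerivAt (x := θ)
    refine (this.sub_const (h x)).congr_of_eventuallyEq (Eventually.of_forall fun v => ?_)
    simp [real_inner_comm]
  refine (h1.pow 2).congr_fderiv ?_
  ext v
  simp

/-- Supplies the growth factor `Z`; its `‖x‖²` term is why moments of order `2p` of the data are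
needed. -/
theorem norm_residual_smul_le (h : EuclideanSpace ℝ (Fin d) → ℝ)
    (ϑ δ x : EuclideanSpace ℝ (Fin d)) :
    ‖(2 * (inner ℝ (δ + ϑ) x - h x)) • x‖ ≤
      (2 * (1 + ‖ϑ‖) * ‖x‖ ^ 2 + 2 * ‖h x • x‖) * (‖δ‖ + 1) := by
  have h1 := abs_real_inner_le_norm (δ + ϑ) x
  have h2 := norm_add_le δ ϑ
  have hx := norm_nonneg x
  rw [norm_smul, norm_smul, Real.norm_eq_abs, Real.norm_eq_abs, abs_mul, abs_two]
  calc 2 * |inner ℝ (δ + ϑ) x - h x| * ‖x‖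
      ≤ 2 * ((‖δ‖ + ‖ϑ‖) * ‖x‖ + |h x|) * ‖x‖ := by
        gcongr
        exact (abs_sub _ _).trans (by gcongr; exact h1.trans (by gcongr))
    _ ≤ _ := by
      have h3 : 0 ≤ ‖ϑ‖ * ‖δ‖ * ‖x‖ ^ 2 := by positivity
      have h4 : 0 ≤ |h x| * ‖x‖ * ‖δ‖ := by positivity
      nlinarith [sq_nonneg ‖x‖]

variable {Ω : Type*} [MeasurableSpace Ω] {P : Measure Ω} {Y : Ω → EuclideanSpace ℝ (Fin d)}
  {h : EuclideanSpace ℝ (Fin d) → ℝ}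

theorem integrable_inner_mul_inner (hY : Measurable Y) (hY2 : Integrable (fun ω => ‖Y ω‖ ^ 2) P)
    (v w : EuclideanSpace ℝ (Fin d)) :
    Integrable (fun ω => inner ℝ v (Y ω) * inner ℝ w (Y ω)) P := by
  refine (hY2.const_mul (‖v‖ * ‖w‖)).mono'
    ((measurable_const.inner hY).mul (measurable_const.inner hY)).aestronglyMeasurable
    (ae_of_all _ fun ω => ?_)
  rw [norm_mul]
  calc _ ≤ (‖v‖ * ‖Y ω‖) * (‖w‖ * ‖Y ω‖) := by
        gcongr <;> exact norm_inner_le_norm _ _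
    _ = _ := by ring

theorem integrable_inner_sq (hY : Measurable Y) (hY2 : Integrable (fun ω => ‖Y ω‖ ^ 2) P)
    (v : EuclideanSpace ℝ (Fin d)) : Integrable (fun ω => inner ℝ v (Y ω) ^ 2) P := by
  simpa only [sq] using integrable_inner_mul_inner hY hY2 v v

theorem integrable_mul_inner (hhY : Integrable (fun ω => h (Y ω) • Y ω) P)
    (v : EuclideanSpace ℝ (Fin d)) : Integrable (fun ω => h (Y ω) * inner ℝ v (Y ω)) P := by
  simpa only [inner_smul_right] using hhY.const_inner (𝕜 := ℝ) v

theorem integrable_residual_mul_inner (hY : Measurable Y)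
    (hY2 : Integrable (fun ω => ‖Y ω‖ ^ 2) P) (hhY : Integrable (fun ω => h (Y ω) • Y ω) P)
    (θ v : EuclideanSpace ℝ (Fin d)) :
    Integrable (fun ω => (inner ℝ θ (Y ω) - h (Y ω)) * inner ℝ v (Y ω)) P := by
  simp only [sub_mul]
  exact (integrable_inner_mul_inner hY hY2 θ v).sub (integrable_mul_inner hhY v)

theorem integrable_leastSquaresLoss (hY : Measurable Y)
    (hY2 : Integrable (fun ω => ‖Y ω‖ ^ 2) P) (hhY : Integrable (fun ω => h (Y ω) • Y ω) P)
    (hh2 : Integrable (fun ω => h (Y ω) ^ 2) P) (θ : EuclideanSpace ℝ (Fin d)) :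
    Integrable (fun ω => leastSquaresLoss h θ (Y ω)) P := by
  refine (((integrable_inner_sq hY hY2 θ).sub ((integrable_mul_inner hhY θ).const_mul 2)).add
    hh2).congr (ae_of_all _ fun ω => ?_)
  simp only [leastSquaresLoss, Pi.add_apply, Pi.sub_apply]
  ring

/-- Pythagoras: `hnormal` kills the cross term. -/
theorem integral_leastSquaresLoss_eq (hY : Measurable Y)
    (hY2 : Integrable (fun ω => ‖Y ω‖ ^ 2) P) (hhY : Integrable (fun ω => h (Y ω) • Y ω) P)
    (hh2 : Integrable (fun ω => h (Y ω) ^ 2) P) {ϑ : EuclideanSpace ℝ (Fin d)}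
    (hnormal : ∀ v, ∫ ω, (inner ℝ ϑ (Y ω) - h (Y ω)) * inner ℝ v (Y ω) ∂P = 0)
    (θ : EuclideanSpace ℝ (Fin d)) :
    ∫ ω, leastSquaresLoss h θ (Y ω) ∂P =
      ∫ ω, leastSquaresLoss h ϑ (Y ω) ∂P + ∫ ω, inner ℝ (θ - ϑ) (Y ω) ^ 2 ∂P := by
  have hL := integrable_leastSquaresLoss hY hY2 hhY hh2 ϑ
  have hS := integrable_inner_sq hY hY2 (θ - ϑ)
  have hR := (integrable_residual_mul_inner hY hY2 hhY ϑ (θ - ϑ)).const_mul 2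
  have h1 : ∀ ω, leastSquaresLoss h θ (Y ω) = leastSquaresLoss h ϑ (Y ω) +
      inner ℝ (θ - ϑ) (Y ω) ^ 2 +
      2 * ((inner ℝ ϑ (Y ω) - h (Y ω)) * inner ℝ (θ - ϑ) (Y ω)) := fun ω => by
    simp only [leastSquaresLoss, inner_sub_left]; ring
  simp only [h1]
  rw [integral_add (f := fun ω => leastSquaresLoss h ϑ (Y ω) + inner ℝ (θ - ϑ) (Y ω) ^ 2)
    (hL.add hS) hR, integral_add hL hS, integral_const_mul, hnormal]
  ring

theorem secondMomentMatrix_mulVec (hY : Measurable Y) (hY2 : Integrable (fun ω => ‖Y ω‖ ^ 2) P)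
    (v : EuclideanSpace ℝ (Fin d)) (i : Fin d) :
    (secondMomentMatrix P Y).mulVec v.ofLp i = ∫ ω, inner ℝ v (Y ω) * Y ω i ∂P := by
  have hij : ∀ j, Integrable (fun ω => Y ω i * Y ω j * v j) P := fun j => by
    refine Integrable.mul_const ?_ _
    simpa [EuclideanSpace.inner_single_left] using
      integrable_inner_mul_inner hY hY2 (EuclideanSpace.single i 1) (EuclideanSpace.single j 1)
  have h1 : ∀ ω, inner ℝ v (Y ω) * Y ω i = ∑ j, Y ω i * Y ω j * v j := fun ω => by
    rw [PiLp.inner_apply, Finset.sum_mul]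
    refine Finset.sum_congr rfl fun j _ => ?_
    simp
    ring
  simp only [h1]
  rw [integral_finsetSum _ fun j _ => hij j]
  simp only [integral_mul_const]
  rfl

theorem integral_residual_mul_inner_eq_zero (hY : Measurable Y)
    (hY2 : Integrable (fun ω => ‖Y ω‖ ^ 2) P) (hhY : Integrable (fun ω => h (Y ω) • Y ω) P)
    {ϑ : EuclideanSpace ℝ (Fin d)}
    (hϑ : (secondMomentMatrix P Y).mulVec ϑ.ofLp = (∫ ω, h (Y ω) • Y ω ∂P).ofLp)
    (v : EuclideanSpace ℝ (Fin d)) :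
    ∫ ω, (inner ℝ ϑ (Y ω) - h (Y ω)) * inner ℝ v (Y ω) ∂P = 0 := by
  have hi : Integrable (fun ω => inner ℝ ϑ (Y ω) • Y ω) P := by
    refine (hY2.const_mul ‖ϑ‖).mono'
      (f := fun ω => inner ℝ ϑ (Y ω) • Y ω)
      (by have : Measurable fun ω => inner ℝ ϑ (Y ω) • Y ω := by fun_prop
          exact this.aestronglyMeasurable) (ae_of_all _ fun ω => ?_)
    rw [norm_smul, sq, ← mul_assoc]
    gcongr
    exact norm_inner_le_norm _ _
  have h0 : ∫ ω, inner ℝ ϑ (Y ω) • Y ω ∂P = ∫ ω, h (Y ω) • Y ω ∂P := by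
    ext i
    rw [← congrFun hϑ i, secondMomentMatrix_mulVec hY hY2]
    have := (EuclideanSpace.proj (𝕜 := ℝ) i).integral_comp_comm hi
    simpa using this.symm
  have h1 : ∀ ω, (inner ℝ ϑ (Y ω) - h (Y ω)) * inner ℝ v (Y ω) =
      inner ℝ v (inner ℝ ϑ (Y ω) • Y ω - h (Y ω) • Y ω) := fun ω => by
    rw [inner_sub_right, inner_smul_right, inner_smul_right, sub_mul]
  simp only [h1]
  rw [integral_inner (f := fun ω => inner ℝ ϑ (Y ω) • Y ω - h (Y ω) • Y ω) (hi.sub hhY) v, integral_sub hi hhY, h0, sub_self, inner_zero_right]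

/-- The quadratic form attains its minimum on the compact unit sphere. It is positive there: if
`E⟨v, Y⟩² = 0` then `⟨v, Y⟩ = 0` almost surely, so the matrix kills `v` and `v = 0`. -/
theorem exists_mul_norm_sq_le_integral_inner_sq (hY : Measurable Y)
    (hY2 : Integrable (fun ω => ‖Y ω‖ ^ 2) P) (hinv : IsUnit (secondMomentMatrix P Y)) :
    ∃ κ : ℝ, 0 < κ ∧ ∀ v, κ * ‖v‖ ^ 2 ≤ ∫ ω, inner ℝ v (Y ω) ^ 2 ∂P := by
  set f : EuclideanSpace ℝ (Fin d) → ℝ := fun v => ∫ ω, inner ℝ v (Y ω) ^ 2 ∂P with hf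
  have hpos : ∀ v, v ≠ 0 → 0 < f v := fun v hv => by
    refine lt_of_le_of_ne (integral_nonneg fun ω => sq_nonneg _) fun h0 => hv ?_
    have h1 := (integral_eq_zero_iff_of_nonneg (fun ω => sq_nonneg _)
      (integrable_inner_sq hY hY2 v)).1 h0.symm
    have h2 : (secondMomentMatrix P Y).mulVec v.ofLp = 0 := by
      ext i
      rw [secondMomentMatrix_mulVec hY hY2]
      refine integral_eq_zero_of_ae ?_
      filter_upwards [h1] with ω hω
      simp [pow_eq_zero_iff two_ne_zero |>.1 hω]
    have h3 := Matrix.mulVec_injective_of_isUnit hinv (h2.trans (Matrix.mulVec_zero _).symm)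
    ext i
    exact congrFun h3 i
  have hfc : Continuous f := by
    have h1 : f = fun v => ∑ i, v i * (secondMomentMatrix P Y).mulVec v.ofLp i := by
      ext v
      simp only [secondMomentMatrix_mulVec hY hY2, ← integral_const_mul]
      rw [← integral_finsetSum]
      · refine integral_congr_ae (ae_of_all _ fun ω => ?_)
        simp only [sq]
        nth_rw 2 [PiLp.inner_apply]
        rw [Finset.mul_sum]
        refine Finset.sum_congr rfl fun i _ => ?_
        simp
        ring
      · intro i _
        refine Integrable.const_mul ?_ _
        simpa [EuclideanSpace.inner_single_left] using
          integrable_inner_mul_inner hY hY2 v (EuclideanSpace.single i 1)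
    rw [h1]
    unfold Matrix.mulVec dotProduct
    fun_prop
  have hscale : ∀ (c : ℝ) v, f (c • v) = c ^ 2 * f v := fun c v => by
    simp only [hf, ← integral_const_mul, inner_smul_left, mul_pow, conj_trivial]
  rcases (Metric.sphere (0 : EuclideanSpace ℝ (Fin d)) 1).eq_empty_or_nonempty with hs | hs
  -- An empty sphere means a trivial space, where any constant works.
  · refine ⟨1, one_pos, fun v => ?_⟩
    have hv : v = 0 := by
      by_contra hv
      have : ‖v‖⁻¹ • v ∈ Metric.sphere (0 : EuclideanSpace ℝ (Fin d)) 1 := by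
        simp [norm_smul, hv]
      simp [hs] at this
    simp [hv]
  · obtain ⟨u, hu, hmin⟩ := (isCompact_sphere (0 : EuclideanSpace ℝ (Fin d)) 1).exists_isMinOn hs
      hfc.continuousOn
    refine ⟨f u, hpos u (ne_zero_of_mem_unit_sphere ⟨u, hu⟩), fun v => ?_⟩
    rcases eq_or_ne v 0 with rfl | hv
    · simp
    have h1 : f u ≤ f (‖v‖⁻¹ • v) := hmin (by simp [norm_smul, hv])
    rw [hscale, inv_pow, inv_mul_eq_div, le_div_iff₀ (by positivity)] at h1
    exact h1

end LeastSquares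

/-! ### Assembly -/

/-- The data `X_1, X_2, …` are `X 0, X 1, …` below, that is, `X n` stands for `X_{n+1}`. -/
theorem mainTheorem7
    (d : ℕ) (hd : 1 ≤ d) (p : ℕ) (hp : 2 ≤ p) (hp_even : Even p)
    (α ν : ℝ) (hα : 0 < α) (hν : ν ∈ Set.Ioo (0 : ℝ) 1)
    (ξ : EuclideanSpace ℝ (Fin d))
    {Ω : Type*} [MeasurableSpace Ω] (P : Measure Ω) [IsProbabilityMeasure P]
    (X : ℕ → Ω → EuclideanSpace ℝ (Fin d))
    (hX_meas : ∀ n, Measurable (X n))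
    (hX_indep : iIndepFun X P)
    (hX_ident : ∀ n, IdentDistrib (X n) (X 0) P P)
    (h : EuclideanSpace ℝ (Fin d) → ℝ) (hh : Measurable h)
    (h_moments : Integrable
      (fun ω => ‖h (X 0 ω) • X 0 ω‖ ^ p + |h (X 0 ω)| ^ 2 + ‖X 0 ω‖ ^ (2 * p)) P)
    (h_inv : IsUnit (secondMomentMatrix P (X 0)))
    (ϑ : EuclideanSpace ℝ (Fin d))
    (hϑ : ϑ = WithLp.toLp 2
      ((secondMomentMatrix P (X 0))⁻¹.mulVec
        (WithLp.ofLp (∫ ω, h (X 0 ω) • X 0 ω ∂P))))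
    (Θ : ℕ → Ω → EuclideanSpace ℝ (Fin d))
    (hΘ_zero : ∀ ω, Θ 0 ω = ξ)
    (hΘ_succ : ∀ n ω, Θ (n + 1) ω = Θ n ω -
      (α / ((n + 1 : ℕ) : ℝ) ^ ν) •
        gradient (fun θ => leastSquaresLoss h θ (X n ω)) (Θ n ω)) :
    (∀ θ, Integrable (fun ω => leastSquaresLoss h θ (X 0 ω)) P) ∧
    {θ : EuclideanSpace ℝ (Fin d) |
      ∫ ω, leastSquaresLoss h θ (X 0 ω) ∂P =
        ⨅ v : EuclideanSpace ℝ (Fin d), ∫ ω, leastSquaresLoss h v (X 0 ω) ∂P} = {ϑ} ∧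
    ∃ C : ℝ, 0 < C ∧ ∀ n : ℕ, 1 ≤ n →
      Integrable (fun ω => ‖Θ n ω - ϑ‖ ^ p) P ∧
      (∫ ω, ‖Θ n ω - ϑ‖ ^ p ∂P) ^ (1 / (p : ℝ)) ≤ C * (n : ℝ) ^ (-(ν / 2)) := by
  obtain ⟨r, rfl⟩ := hp_even
  obtain ⟨q, rfl⟩ : ∃ q, r = q + 1 := ⟨r - 1, by omega⟩
  have hpq : q + 1 + (q + 1) = 2 * (q + 1) := by ring
  rw [hpq] at h_moments ⊢
  have hY := hX_meas 0
  have hYh := hh.comp hY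
  have hm1 : Integrable (fun ω => ‖h (X 0 ω) • X 0 ω‖ ^ (2 * (q + 1))) P :=
    h_moments.mono' ((hYh.smul hY).norm.pow_const _).aestronglyMeasurable
      (ae_of_all _ fun ω => by
        change ‖‖h (X 0 ω) • X 0 ω‖ ^ (2 * (q + 1))‖ ≤ _
        rw [Real.norm_of_nonneg (by positivity), add_assoc]
        refine le_add_of_nonneg_right ?_
        positivity)
  have hm2 : Integrable (fun ω => h (X 0 ω) ^ 2) P :=
    h_moments.mono' (hYh.pow_const 2).aestronglyMeasurable
      (ae_of_all _ fun ω => by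
        change ‖h (X 0 ω) ^ 2‖ ≤ _
        rw [Real.norm_of_nonneg (by positivity), ← sq_abs, add_right_comm]
        refine le_add_of_nonneg_left ?_
        positivity)
  have hm3 : Integrable (fun ω => ‖X 0 ω‖ ^ (2 * (2 * (q + 1)))) P :=
    h_moments.mono' (hY.norm.pow_const _).aestronglyMeasurable
      (ae_of_all _ fun ω => by
        rw [Real.norm_of_nonneg (by positivity)]
        refine le_add_of_nonneg_left ?_
        positivity)
  have hY2 : Integrable (fun ω => ‖X 0 ω‖ ^ 2) P :=
    hm3.norm_pow_of_le hY (by omega)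
  have hhY : Integrable (fun ω => h (X 0 ω) • X 0 ω) P := by
    have h1 := hm1.norm_pow_of_le (hYh.smul hY) (show 1 ≤ 2 * (q + 1) by omega)
    simp only [pow_one] at h1
    exact (integrable_norm_iff (hYh.smul hY).aestronglyMeasurable).1 h1
  have hnormal : ∀ v, ∫ ω, (inner ℝ ϑ (X 0 ω) - h (X 0 ω)) * inner ℝ v (X 0 ω) ∂P = 0 := by
    refine integral_residual_mul_inner_eq_zero hY hY2 hhY ?_
    rw [hϑ, WithLp.ofLp_toLp, Matrix.mulVec_mulVec,
      Matrix.mul_nonsing_inv _ ((Matrix.isUnit_iff_isUnit_det _).1 h_inv), Matrix.one_mulVec]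
  obtain ⟨κ, hκ, hcoer⟩ := exists_mul_norm_sq_le_integral_inner_sq hY hY2 h_inv
  have hLi := fun θ => integrable_leastSquaresLoss hY hY2 hhY hm2 θ
  have hLe := fun θ => integral_leastSquaresLoss_eq hY hY2 hhY hm2 hnormal θ
  refine ⟨hLi, ?_, ?_⟩
  · have hmin : ∀ θ, ∫ ω, leastSquaresLoss h ϑ (X 0 ω) ∂P ≤
        ∫ ω, leastSquaresLoss h θ (X 0 ω) ∂P := fun θ => by
      rw [hLe θ]
      exact le_add_of_nonneg_right (integral_nonneg fun ω => sq_nonneg _)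
    have hinf : ⨅ v, ∫ ω, leastSquaresLoss h v (X 0 ω) ∂P =
        ∫ ω, leastSquaresLoss h ϑ (X 0 ω) ∂P :=
      le_antisymm (ciInf_le ⟨_, Set.forall_mem_range.2 hmin⟩ ϑ) (le_ciInf hmin)
    ext θ
    rw [Set.mem_ofPred_eq, Set.mem_singleton_iff, hinf, hLe θ, add_eq_left]
    refine ⟨fun h0 => ?_, fun h0 => by simp [h0]⟩
    have h1 := hcoer (θ - ϑ)
    rw [h0] at h1
    have h2 : ‖θ - ϑ‖ ^ 2 = 0 := le_antisymm (by nlinarith [sq_nonneg ‖θ - ϑ‖]) (sq_nonneg _)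
    exact sub_eq_zero.1 (norm_eq_zero.1 (pow_eq_zero_iff two_ne_zero |>.1 h2))
  · have hrec : ∀ n ω, Θ (n + 1) ω - ϑ = (Θ n ω - ϑ) - (α / ((n + 1 : ℕ) : ℝ) ^ ν) •
        ((2 * (inner ℝ (Θ n ω - ϑ + ϑ) (X n ω) - h (X n ω))) • X n ω) := fun n ω => by
      rw [hΘ_succ, gradient_leastSquaresLoss, sub_add_cancel]
      abel
    -- The second summand has mean zero by `hnormal`, so the drift constant is `2 * κ`.
    have hinn : ∀ δ ω, inner ℝ δ ((2 * (inner ℝ (δ + ϑ) (X 0 ω) - h (X 0 ω))) • X 0 ω) =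
        2 * inner ℝ δ (X 0 ω) ^ 2 +
          2 * ((inner ℝ ϑ (X 0 ω) - h (X 0 ω)) * inner ℝ δ (X 0 ω)) := fun δ ω => by
      rw [inner_smul_right, inner_add_left]; ring
    have hi1 := fun δ => (integrable_inner_sq hY hY2 δ).const_mul 2
    have hi2 := fun δ => (integrable_residual_mul_inner hY hY2 hhY ϑ δ).const_mul 2
    have hGm : Measurable fun z : EuclideanSpace ℝ (Fin d) × EuclideanSpace ℝ (Fin d) =>
        (2 * (inner ℝ (z.1 + ϑ) z.2 - h z.2)) • z.2 := by fun_prop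
    have hZm : Measurable fun x => 2 * (1 + ‖ϑ‖) * ‖x‖ ^ 2 + 2 * ‖h x • x‖ := by fun_prop
    obtain ⟨hint, C, hC, hbound⟩ := exists_integral_norm_pow_le_stepSize (P := P) q hα hν hX_meas
      hX_indep hX_ident (G := fun δ x => (2 * (inner ℝ (δ + ϑ) x - h x)) • x)
      hGm
      (Z := fun x => 2 * (1 + ‖ϑ‖) * ‖x‖ ^ 2 + 2 * ‖h x • x‖)
      hZm
      (fun x => by positivity)
      (integrable_one_add_add_pow hY (hYh.smul hY) hm3 hm1 (by positivity))
      (norm_residual_smul_le h ϑ) (κ := 2 * κ) (by positivity)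
      (fun δ => by simp only [hinn]; exact (hi1 δ).add (hi2 δ))
      (fun δ => by
        simp only [hinn]
        rw [integral_add (hi1 δ) (hi2 δ), integral_const_mul, integral_const_mul, hnormal]
        linarith [hcoer δ])
      (Δ := fun n ω => Θ n ω - ϑ) (δ₀ := ξ - ϑ) (fun ω => by rw [hΘ_zero]) hrec
    refine ⟨(C * α ^ (q + 1)) ^ (1 / ((2 * (q + 1) : ℕ) : ℝ)), by positivity,
      fun n hn => ⟨hint n, ?_⟩⟩
    have hn0 : (0 : ℝ) < n := by exact_mod_cast hn
    have h1 := hbound n hn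
    -- Written as a `p`-th power of `n^(-ν/2)`, ready for the `p`-th root.
    have h2 : C * (α / (n : ℝ) ^ ν) ^ (q + 1) =
        C * α ^ (q + 1) * ((n : ℝ) ^ (-(ν / 2))) ^ (2 * (q + 1)) := by
      rw [pow_mul, ← Real.rpow_natCast ((n : ℝ) ^ (-(ν / 2))) 2, ← Real.rpow_mul hn0.le, div_pow]
      rw [show -(ν / 2) * ((2 : ℕ) : ℝ) = -ν by push_cast; ring, Real.rpow_neg hn0.le, inv_pow, div_eq_mul_inv]
      ring
    rw [h2] at h1
    refine (Real.rpow_le_rpow (integral_nonneg fun ω => by positivity) h1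
      (by positivity)).trans (le_of_eq ?_)
    rw [Real.mul_rpow (by positivity) (by positivity), one_div,
      Real.pow_rpow_inv_natCast (by positivity) (by positivity)]
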